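/- **Setting.** An instance $I=(G,w,\overline F)$ of Flexible Graph Connectivity (FGC) consists of a finite connected loopless multigraph $G=(V,E)$, weights $w\colon E\to\mathbb R_{\ge 0}$ and a set $\overline F\subseteq E$ of safe edges; the edges in $F:=E\setminus\overline F$ are unsafe. A set $S\subseteq E$ is feasible if $(V,S)$ is connected and $(V,S\setminus\{f\})$ is connected for every $f\in F$; $\mathrm{OPT}(I)$ is the minimum weight of a feasible set. It is assumed that every safe edge has a parallel unsafe edge of the same weight. For $\alpha\in[0,1]$ let $w_\alpha(e)=\alpha\, w(e)$ for $e\in\overline F$ and $w_\alpha(e)=w(e)$ for $e\in F$. An $\alpha$-MST is a spanning tree of $G$ of minimum $w_\alpha$-weight. Ties are broken by a fixed injective priority function $p\colon E\to\mathbb R$, arbitrary except that every safe edge has smaller priority than every unsafe edge: $T_\alpha$ denotes the unique $\alpha$-MST of minimum total priority (the tree that Kruskal's algorithm finds when edges of equal $w_\alpha$-weight are scanned in the order of $p$). The threshold value of a safe edge $e$ is $\alpha_e=\sup\{\alpha\in[0,1] : e\in T_\alpha\}$ (with $\alpha_e=0$ if there is no such $\alpha$); the threshold value of an unsafe edge $f$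 is $\alpha_f=\inf\{\alpha\in[0,1] : f\in T_\alpha\}$ (with $\alpha_f=\infty$ if there is no such $\alpha$). The threshold values of $I$ are the finite numbers among the $\alpha_e$, $e\in E$. Let $\lambda,\tau\ge 1$. A 2-ECSS of a graph is a 2-edge-connected spanning subgraph, and a solution of a minimization problem is called $\rho$-approximate if its weight is at most $\rho$ times the minimum. **Algorithm 1** does the following. * Algorithm A: compute a $\lambda$-approximate 2-ECSS $H$ of $(G,w)$, and let $Z^A$ be $H$ without the unsafe edges that are parallel to a safe edge of $H$. * For each $\alpha\in W:=\{\text{threshold values of } I\}\cup\{0,1\}$ let $G_\alpha:=G/(T_\alpha\cap\overline F)$ be the graph obtained by contracting the safe edges of $T_\alpha$. Algorithm B: compute a $\tau$-approximate set $L\subseteq E(G_\alpha)\setminus T_\alpha$ such that $(T_\alpha\cap F)\cup L$ is a 2-ECSS of $G_\alpha$, and let $Z^B_\alpha:=T_\alpha\cup L$. Algorithm C: compute a $\lambda$-approximate 2-ECSS $H'$ of $(G_\alpha,w)$, and let $Z^C_\alpha:=(T_\alpha\cap\overline F)\cup H'$. * Return a solution of minimum weight among $Z^A$ and all $Z^B_\alpha,Z^C_\alpha$,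 $\alpha\in W$. **Theorem.** Let $N\ge 1$ and $\lambda,\tau\ge1$. The maximization problem $$ \begin{aligned} \max\ & \lambda\Bigl(1+\sum_{j=1}^N\alpha_j\hat\beta_j\Bigr)\\ \text{subject to } & \sum_{j=1}^N\hat\beta_j\bigl(1+\alpha_j(\lambda-1+\lambda\alpha_j)\bigr)=1,\\ & 0\le\alpha_1\le\alpha_2\le\dots\le\alpha_N\le1,\qquad \hat\beta_j\in[0,1]\ \text{ for } j=1,\dots,N, \end{aligned} $$ attains its maximum; let $\rho$ be its optimal value. Then for every instance $I$ as above with at most $N$ threshold values, every solution $Z$ that Algorithm 1 can return (for any such tie-breaking $p$ and any choice of the approximate solutions in its steps) is feasible, and if $Z^*$ is an optimal solution of $I$, then $w(Z)\le\rho\cdot w(Z^*)=\rho\cdot\mathrm{OPT}(I)$. -/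

import Mathlib

namespace FGC

/-! ### Finite multigraphs: connectivity, spanning trees, contraction -/

/-- A (multi)graph is connected: it has a vertex, and any two vertices are joined by a walk. -/
def Connected {α β : Type*} (G : Graph α β) : Prop :=
  G.vertexSet.Nonempty ∧
    ∀ u ∈ G.vertexSet, ∀ v ∈ G.vertexSet, Relation.ReflTransGen G.Adj u v

/-- A graph is 2-edge-connected: it is connected and stays so when any one edge is deleted.
(A single vertex is 2-edge-connected.) -/
def TwoEdgeConnected {α β : Type*} (G : Graph α β) : Prop :=
  Connected G ∧ ∀ e ∈ G.edgeSet, Connected (G.deleteEdges {e})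

/-- `T` is the edge set of a spanning tree of `G`: the graph `(V(G), T)` is connected, and
deleting any edge of `T` disconnects it. -/
def IsSpanningTree {α β : Type*} (G : Graph α β) (T : Set β) : Prop :=
  T ⊆ G.edgeSet ∧ Connected (G.restrict T) ∧ ∀ e ∈ T, ¬ Connected (G.restrict (T \ {e}))

/-- The vertex set of the component of `v` in the graph `(V(G), C)`. -/
def component {α β : Type*} (G : Graph α β) (C : Set β) (v : α) : Set α :=
  {u | Relation.ReflTransGen (G.restrict C).Adj v u}

/-- The graph `G / C` obtained by contracting the edges in `C`: its vertices are the components of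
`(V(G), C)`, and its edges are the edges of `G` that are not in `C`. -/
def contract {α β : Type*} (G : Graph α β) (C : Set β) : Graph (Set α) β :=
  (G.deleteEdges C).map (component G C)

/-- The total weight of an edge set. -/
noncomputable def cost {β : Type*} [Fintype β] (w : β → ℝ) (X : Set β) : ℝ :=
  ∑ e, X.indicator w e

/-! ### The problems 2-ECSS and WTAP -/

/-- `H` is (the edge set of) a 2-edge-connected spanning subgraph of `G`. -/
def IsTwoECSS {α β : Type*} (G : Graph α β) (H : Set β) : Prop :=
  H ⊆ G.edgeSet ∧ TwoEdgeConnected (G.restrict H)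

/-- `H` is a `lam`-approximate solution of the 2-ECSS instance `(G, w)`. -/
def IsApproxTwoECSS {α β : Type*} [Fintype β] (G : Graph α β) (w : β → ℝ) (lam : ℝ)
    (H : Set β) : Prop :=
  IsTwoECSS G H ∧ ∀ H', IsTwoECSS G H' → cost w H ≤ lam * cost w H'

/-- `L` is a feasible solution of the weighted tree augmentation instance with graph `G` and
spanning tree `T`: adding `L` to `T` gives a 2-edge-connected spanning subgraph. -/
def IsAugmentation {α β : Type*} (G : Graph α β) (T L : Set β) : Prop :=
  L ⊆ G.edgeSet \ T ∧ TwoEdgeConnected (G.restrict (T ∪ L))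

/-- `L` is a `tau`-approximate solution of the WTAP instance `(G, T, w)`. -/
def IsApproxAugmentation {α β : Type*} [Fintype β] (G : Graph α β) (T : Set β) (w : β → ℝ)
    (tau : ℝ) (L : Set β) : Prop :=
  IsAugmentation G T L ∧ ∀ L', IsAugmentation G T L' → cost w L ≤ tau * cost w L'

/-! ### Flexible graph connectivity -/

/-- An instance `(G, w, F̄)` of the flexible graph connectivity problem: a connected loopless
multigraph, non-negative edge weights, and a set of safe edges. The other edges are unsafe. -/
structure Instance (V E : Type*) where
  graph : Graph V E
  weight : E → ℝ
  safe : Set E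
  connected : Connected graph
  loopless : graph.Loopless
  weight_nonneg : ∀ e ∈ graph.edgeSet, 0 ≤ weight e
  safe_subset : safe ⊆ graph.edgeSet

namespace Instance

variable {V E : Type*}

/-- The unsafe edges. -/
def unsafeEdges (I : Instance V E) : Set E := I.graph.edgeSet \ I.safe

/-- Two edges are parallel: they have the same ends. -/
def Parallel (I : Instance V E) (e f : E) : Prop :=
  ∃ u v, I.graph.IsLink e u v ∧ I.graph.IsLink f u v

/-- Each safe edge has a parallel unsafe edge of the same weight. -/
def HasUnsafeCopies (I : Instance V E) : Prop :=
  ∀ e ∈ I.safe, ∃ f ∈ I.unsafeEdges, I.Parallel e f ∧ I.weight f = I.weight e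

/-- `S` is feasible: `(V, S)` is connected, and remains so if any one unsafe edge fails. -/
def IsFeasible (I : Instance V E) (S : Set E) : Prop :=
  S ⊆ I.graph.edgeSet ∧ Connected (I.graph.restrict S) ∧
    ∀ f ∈ I.unsafeEdges, Connected (I.graph.restrict (S \ {f}))

/-- `S` is an optimal solution. -/
def IsOptimal [Fintype E] (I : Instance V E) (S : Set E) : Prop :=
  I.IsFeasible S ∧ ∀ S', I.IsFeasible S' → cost I.weight S ≤ cost I.weight S'

/-! ### Scaled weights, minimum spanning trees, threshold values -/

open Classical in
/-- The weights obtained by scaling the weights of the safe edges by `a`. -/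
noncomputable def scaledWeight (I : Instance V E) (a : ℝ) (e : E) : ℝ :=
  if e ∈ I.safe then a * I.weight e else I.weight e

/-- `T` is an `a`-MST: a spanning tree of minimum weight for the weights scaled by `a`. -/
def IsAlphaMST [Fintype E] (I : Instance V E) (a : ℝ) (T : Set E) : Prop :=
  IsSpanningTree I.graph T ∧
    ∀ T', IsSpanningTree I.graph T' → cost (I.scaledWeight a) T ≤ cost (I.scaledWeight a) T'

/-- A tie-breaking rule: edges have pairwise distinct priorities, and safe edges come before
unsafe edges. -/
def IsTieBreaking (I : Instance V E) (p : E → ℝ) : Prop :=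
  Set.InjOn p I.graph.edgeSet ∧ ∀ e ∈ I.safe, ∀ f ∈ I.unsafeEdges, p e < p f

/-- `T` is the `a`-MST selected by the tie-breaking rule `p`: among all `a`-MSTs it has the
smallest total priority. Equivalently, `T` is of minimum weight for the scaled weights perturbed by
an infinitesimal positive multiple of `p`; as `p` is injective, there is only one such tree, the
one found by Kruskal's algorithm when edges of equal scaled weight are scanned in the order `p`. -/
def IsSelectedMST [Fintype E] (I : Instance V E) (p : E → ℝ) (a : ℝ) (T : Set E) : Prop :=
  I.IsAlphaMST a T ∧ ∀ T', I.IsAlphaMST a T' → cost p T ≤ cost p T'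

/-- The scaling factors in `[0, 1]` for which the selected minimum spanning tree contains `e`. -/
def selectedFactors [Fintype E] (I : Instance V E) (p : E → ℝ) (e : E) : Set ℝ :=
  {a | a ∈ Set.Icc (0 : ℝ) 1 ∧ ∃ T, I.IsSelectedMST p a T ∧ e ∈ T}

/-- `t` is the (finite) threshold value of the edge `e`. The upper threshold of a safe edge is the
point of `[0, 1]` up to which `e` is in the selected minimum spanning tree (it is `0` if `e` is
never selected); the lower threshold of an unsafe edge is the point from which on `e` is in it.
An unsafe edge that is never selected has lower threshold `∞`, hence no finite one. -/
def IsThreshold [Fintype E] (I : Instance V E) (p : E → ℝ) (e : E) (t : ℝ) : Prop :=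
  (e ∈ I.safe ∧ t = sSup (I.selectedFactors p e)) ∨
    (e ∈ I.unsafeEdges ∧ (I.selectedFactors p e).Nonempty ∧ t = sInf (I.selectedFactors p e))

/-- The set of (finite) threshold values of the instance. -/
def thresholdValues [Fintype E] (I : Instance V E) (p : E → ℝ) : Set ℝ :=
  {t | ∃ e, I.IsThreshold p e t}

/-- The scaling factors used by the algorithm: the threshold values together with `0` and `1`. -/
def scalingFactors [Fintype E] (I : Instance V E) (p : E → ℝ) : Set ℝ :=
  I.thresholdValues p ∪ {0, 1}

/-! ### The algorithms A, B, C and their combination -/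

/-- `Z` is a possible output of Algorithm A: compute a `lam`-approximate 2-edge-connected spanning
subgraph `H`, and remove from it all unsafe edges that are parallel to a safe edge of `H`. -/
def IsOutputA [Fintype E] (I : Instance V E) (lam : ℝ) (Z : Set E) : Prop :=
  ∃ H, IsApproxTwoECSS I.graph I.weight lam H ∧
    Z = {e ∈ H | ¬ (e ∈ I.unsafeEdges ∧ ∃ f ∈ H, f ∈ I.safe ∧ I.Parallel e f)}

/-- `Z` is a possible output of Algorithm B with spanning tree `T`: contract the safe edges of `T`
and add to `T` a `tau`-approximate augmentation of the contracted tree. -/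
def IsOutputB [Fintype E] (I : Instance V E) (tau : ℝ) (T Z : Set E) : Prop :=
  ∃ L, IsApproxAugmentation (contract I.graph (T ∩ I.safe)) (T \ I.safe) I.weight tau L ∧
    Z = T ∪ L

/-- `Z` is a possible output of Algorithm C with spanning tree `T`: contract the safe edges of `T`
and add to them a `lam`-approximate 2-edge-connected spanning subgraph of the contracted graph. -/
def IsOutputC [Fintype E] (I : Instance V E) (lam : ℝ) (T Z : Set E) : Prop :=
  ∃ H, IsApproxTwoECSS (contract I.graph (T ∩ I.safe)) I.weight lam H ∧
    Z = (T ∩ I.safe) ∪ H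

/-- `Z` is a possible output of the combined algorithm: run Algorithm A, run Algorithms B and C
with the selected `a`-MST for each scaling factor `a`, and return a solution of minimum weight
among all solutions that were found. -/
def IsOutput [Fintype E] (I : Instance V E) (p : E → ℝ) (lam tau : ℝ) (Z : Set E) : Prop :=
  ∃ (ZA : Set E) (T ZB ZC : ℝ → Set E),
    I.IsOutputA lam ZA ∧
    (∀ a ∈ I.scalingFactors p, I.IsSelectedMST p a (T a) ∧
      I.IsOutputB tau (T a) (ZB a) ∧ I.IsOutputC lam (T a) (ZC a)) ∧
    Z ∈ {ZA} ∪ ZB '' I.scalingFactors p ∪ ZC '' I.scalingFactors p ∧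
    ∀ Z' ∈ {ZA} ∪ ZB '' I.scalingFactors p ∪ ZC '' I.scalingFactors p,
      cost I.weight Z ≤ cost I.weight Z'

end Instance

/-- The objective values of the feasible points of the maximization problem with parameters
`N` and `lam`. -/
def problemValues (N : ℕ) (lam : ℝ) : Set ℝ :=
  {x | ∃ a b : Fin N → ℝ,
    ∑ j, b j * (1 + a j * (lam - 1 + lam * a j)) = 1 ∧
    Monotone a ∧ (∀ j, a j ∈ Set.Icc (0 : ℝ) 1) ∧ (∀ j, b j ∈ Set.Icc (0 : ℝ) 1) ∧
    x = lam * (1 + ∑ j, a j * b j)}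

end FGC

/-! Fix an optimal solution `Y` of minimum priority among the optimal ones. Let `S` be its safe
bridges and θ the upper threshold. The key is an exchange: given a set `K` of safe edges to be
contracted, the edges of `S \ K` can be replaced by unsafe edges of total weight at most the sum of
θ(e) w(e) over `S \ K` (`SafeMinimal.exists_replacement`). Adding the replacements to `Y \ K` gives
a 2-ECSS of `G / K` (`SafeMinimal.exists_augmentation`).

Write O = w(Y), β = w(S), and D, D₂ for the sums of θw, θ²w over `S`; let z be the weight of the
output. For K = ∅, Algorithm A gives z ≤ λ(O + D), and dropping `S` shows that a 1-MST weighs at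
most O − β + D. For K the safe edges of the selected tree, Algorithm C gives one bound per scaling
factor. Averaged with the gaps between consecutive factors as weights, these telescope to z ≤ mst(1)
+ λ(O − D₂) (`le_of_forall_scalingFactors`), since at a factor a > 0 the selected tree contains
exactly the safe edges with θ ≥ a.

With σ = β + (λ−1)D + λD₂ the second bound is z ≤ (λ+1)O − σ + λD. The first bound (if σ ≤ O) or the
second (if σ ≥ O) yields z ≤ λ(1 + D/σ)O. Grouping `S` by thresholds makes λ(1 + D/σ) a value of the
maximization problem (`mem_problemValues`). -/

namespace FGC

/-! ### Walks, cuts, exchanges and contractions in multigraphs. -/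

section Graph

variable {α β : Type*} {G : Graph α β} {X Y K H Q T U : Set β} {u v x y : α} {e f : β}

/-- `u` and `v` are joined by a walk with edges in `X`. -/
def Joined (G : Graph α β) (X : Set β) (u v : α) : Prop :=
  Relation.ReflTransGen (G.restrict X).Adj u v

/-- `e` has one end in `U` and one end outside. -/
def Crosses (G : Graph α β) (U : Set α) (e : β) : Prop :=
  ∃ x ∈ U, ∃ y ∉ U, G.IsLink e x y

lemma Joined.symm (h : Joined G X u v) : Joined G X v u := by
  induction h with
  | refl => exact .refl
  | tail _ h ih => exact .head h.symm ih

lemma Joined.trans {w : α} (h : Joined G X u v) (h' : Joined G X v w) : Joined G X u w :=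
  Relation.ReflTransGen.trans h h'

lemma Joined.of_isLink (he : e ∈ X) (h : G.IsLink e u v) : Joined G X u v :=
  .single ⟨e, he, h⟩

lemma Joined.lift (h : Joined G X u v)
    (hXY : ∀ e ∈ X, ∀ x y, G.IsLink e x y → Joined G Y x y) : Joined G Y u v := by
  induction h with
  | refl => exact .refl
  | tail _ h ih =>
    obtain ⟨e, he, hl⟩ := h
    exact ih.trans (hXY e he _ _ hl)

lemma Joined.mono (h : Joined G X u v) (hXY : X ⊆ Y) : Joined G Y u v :=
  h.lift fun _ he _ _ hl => .of_isLink (hXY he) hl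

lemma Joined.exists_crosses {U : Set α} (h : Joined G X u v) (hu : u ∈ U) (hv : v ∉ U) :
    ∃ e ∈ X, Crosses G U e := by
  induction h with
  | refl => exact absurd hu hv
  | @tail b c _ h ih =>
    by_cases hb : b ∈ U
    · obtain ⟨e, he, hl⟩ := h
      exact ⟨e, he, b, hb, c, hv, hl⟩
    · exact ih hb

/-- After shortcutting, a walk uses `f` at most once, in one of its two directions. -/
lemma Joined.of_insert (hf : G.IsLink f x y) (h : Joined G (insert f X) u v) :
    Joined G X u v ∨ (Joined G X u x ∧ Joined G X y v) ∨ (Joined G X u y ∧ Joined G X x v) := by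
  induction h with
  | refl => exact .inl .refl
  | @tail b c _ h ih =>
    obtain ⟨e, he, hl⟩ := h
    rcases he with rfl | he
    · rcases hf.eq_and_eq_or_eq_and_eq hl with ⟨rfl, rfl⟩ | ⟨rfl, rfl⟩
      · rcases ih with ih | ih | ih
        · exact .inr (.inl ⟨ih, .refl⟩)
        · exact .inr (.inl ⟨ih.1, .refl⟩)
        · exact .inl ih.1
      · rcases ih with ih | ih | ih
        · exact .inr (.inr ⟨ih, .refl⟩)
        · exact .inl ih.1
        · exact .inr (.inr ⟨ih.1, .refl⟩)
    · have hbc : Joined G X b c := .of_isLink he hl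
      rcases ih with ih | ih | ih
      · exact .inl (ih.trans hbc)
      · exact .inr (.inl ⟨ih.1, ih.2.trans hbc⟩)
      · exact .inr (.inr ⟨ih.1, ih.2.trans hbc⟩)

/-- A walk between `x` and `y` must use `e`; its remaining two pieces, closed up by `f`, connect the
ends of `e`. -/
lemma Joined.exchange (he : G.IsLink e u v) (hf : G.IsLink f x y)
    (h : Joined G (insert e X) x y) (hn : ¬ Joined G X x y) : Joined G (insert f X) u v := by
  have hxy : Joined G (insert f X) x y := .of_isLink (Set.mem_insert _ _) hf
  have hs : X ⊆ insert f X := Set.subset_insert _ _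
  rcases h.of_insert he with h | ⟨h1, h2⟩ | ⟨h1, h2⟩
  · exact absurd h hn
  · exact (h1.symm.mono hs).trans (hxy.trans (h2.symm.mono hs))
  · exact (h2.mono hs).trans (hxy.symm.trans (h1.mono hs))

lemma Connected.lift (h : Connected (G.restrict X))
    (hXY : ∀ e ∈ X, ∀ x y, G.IsLink e x y → Joined G Y x y) : Connected (G.restrict Y) :=
  ⟨h.1, fun u hu v hv => Joined.lift (h.2 u hu v hv) hXY⟩

lemma Connected.mono (h : Connected (G.restrict X)) (hXY : X ⊆ Y) : Connected (G.restrict Y) :=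
  h.lift fun _ he _ _ hl => .of_isLink (hXY he) hl

lemma Connected.joined (h : Connected (G.restrict X)) (hl : G.IsLink e x y) : Joined G X x y :=
  h.2 x hl.left_mem y hl.right_mem

lemma Connected.exists_mem_crosses {U : Set α} (h : Connected (G.restrict X))
    (he : Crosses G U e) : ∃ q ∈ X, Crosses G U q := by
  obtain ⟨x, hx, y, hy, hl⟩ := he
  exact (h.joined hl).exists_crosses hx hy

/-- The fundamental cut: `U` consists of what one end of `e` still reaches in `Q \ {e}`. -/
lemma Connected.exists_cut (h : Connected (G.restrict Q))
    (hn : ¬ Connected (G.restrict (Q \ {e}))) :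
    ∃ U, Crosses G U e ∧ ∀ q ∈ Q, Crosses G U q → q = e := by
  have : ∃ q ∈ Q, ∃ x y, G.IsLink q x y ∧ ¬ Joined G (Q \ {e}) x y := by
    by_contra! hc
    exact hn (h.lift hc)
  obtain ⟨q, hq, x, y, hl, hj⟩ := this
  have hqe : q = e := by
    by_contra hqe
    exact hj (.of_isLink ⟨hq, hqe⟩ hl)
  subst hqe
  refine ⟨{z | Joined G (Q \ {q}) x z}, ⟨x, .refl, y, hj, hl⟩, ?_⟩
  rintro r hr ⟨a, ha, b, hb, hab⟩
  by_contra hrq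
  exact hb (Joined.trans ha (.of_isLink ⟨hr, hrq⟩ hab))

lemma Connected.swap {U : Set α} (h : Connected (G.restrict Q))
    (hU : ∀ q ∈ Q, Crosses G U q → q = e) (hf : Crosses G U f) :
    Connected (G.restrict (insert f (Q \ {e}))) := by
  refine h.lift fun q hq u v hl => ?_
  by_cases hqe : q = e
  · subst hqe
    obtain ⟨x, hx, y, hy, hxy⟩ := hf
    refine Joined.exchange hl hxy ((h.joined hxy).mono ?_) fun hj => ?_
    · intro r hr
      by_cases hrq : r = q
      · exact .inl hrq
      · exact .inr ⟨hr, hrq⟩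
    · obtain ⟨r, hr, hc⟩ := hj.exists_crosses hx hy
      exact hr.2 (hU r hr.1 hc)
  · exact .of_isLink (.inr ⟨hq, hqe⟩) hl

lemma Joined.exists_minimal [Finite β] (h : Joined G X x y) :
    ∃ B ⊆ X, Joined G B x y ∧ ∀ b ∈ B, ¬ Joined G (B \ {b}) x y := by
  obtain ⟨B, hBX, hB⟩ := (Set.toFinite {B : Set β | Joined G B x y}).exists_le_minimal h
  refine ⟨B, hBX, hB.prop, fun b hb hj => ?_⟩
  exact (hB.le_of_le hj Set.sdiff_subset hb).2 rfl

/-- The ends of `b` are joined by the rest of the cycle formed by `B` and `e`. -/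
lemma Joined.of_minimal {B : Set β} {b : β} (hB : Joined G B x y)
    (hmin : ∀ b ∈ B, ¬ Joined G (B \ {b}) x y) (hb : b ∈ B) (he : G.IsLink e x y)
    (hl : G.IsLink b u v) : Joined G (insert e (B \ {b})) u v := by
  refine Joined.exchange hl he ?_ (hmin b hb)
  rwa [Set.insert_sdiff_singleton, Set.insert_eq_of_mem hb]

lemma component_eq_iff : component G K u = component G K v ↔ Joined G K u v := by
  constructor
  · intro h
    have : v ∈ component G K v := Relation.ReflTransGen.refl
    rw [← h] at this
    exact this
  · intro h
    ext z
    exact ⟨fun hz => h.symm.trans hz, fun hz => h.trans hz⟩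

/-- Walks in `G / K` lift to `G` by inserting walks in `K` within the components. This turns every
question about contractions into one about edge sets of `G`. -/
lemma connected_contract_iff :
    Connected ((contract G K).restrict H) ↔ Connected (G.restrict (K ∪ H)) := by
  constructor
  · rintro ⟨hne, h⟩
    have hV : G.vertexSet.Nonempty := by
      obtain ⟨_, v, hv, rfl⟩ := hne
      exact ⟨v, hv⟩
    refine ⟨hV, fun u hu v hv => ?_⟩
    have key : ∀ a b : Set α, Relation.ReflTransGen ((contract G K).restrict H).Adj a b →
        component G K u = a → ∀ v, component G K v = b → Joined G (K ∪ H) u v := by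
      intro a b hab hu
      induction hab with
      | refl =>
        rintro v rfl
        exact (component_eq_iff.1 hu).mono Set.subset_union_left
      | tail _ h ih =>
        obtain ⟨e, he, x, y, hl, rfl, rfl⟩ := h
        intro v hv
        have hl' : G.IsLink e x y := hl.mono Graph.deleteEdges_le
        exact (ih x rfl).trans (Joined.trans (.of_isLink (.inr he) hl')
          ((component_eq_iff.1 hv).symm.mono Set.subset_union_left))
    exact key _ _ (h _ ⟨u, hu, rfl⟩ _ ⟨v, hv, rfl⟩) rfl v rfl
  · rintro ⟨⟨z, hz⟩, h⟩
    refine ⟨⟨_, z, hz, rfl⟩, ?_⟩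
    rintro _ ⟨u, hu, rfl⟩ _ ⟨v, hv, rfl⟩
    have := h u hu v hv
    induction this with
    | refl => exact .refl
    | @tail b c _ hbc ih =>
      obtain ⟨e, he, hl⟩ := hbc
      have hl : G.IsLink e b c := hl
      have ih := ih hl.left_mem
      by_cases heK : e ∈ K
      · rwa [component_eq_iff.2 (Joined.of_isLink heK hl)] at ih
      · refine ih.tail ⟨e, he.resolve_left heK, b, c, ?_, rfl, rfl⟩
        simp [hl, heK]

lemma restrict_deleteEdges_singleton :
    (G.restrict X).deleteEdges {e} = G.restrict (X \ {e}) := by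
  refine Graph.ext rfl ?_
  intro e x y
  simp only [Graph.deleteEdges_isLink, Graph.restrict_isLink, Set.mem_sdiff]
  tauto

lemma twoEdgeConnected_restrict_iff (hX : X ⊆ G.edgeSet) : TwoEdgeConnected (G.restrict X) ↔
    Connected (G.restrict X) ∧ ∀ e ∈ X, Connected (G.restrict (X \ {e})) := by
  unfold TwoEdgeConnected
  simp only [restrict_deleteEdges_singleton]
  have : (G.restrict X).edgeSet = X := Set.inter_eq_right.2 hX
  rw [this]

lemma edgeSet_contract : (contract G K).edgeSet = G.edgeSet \ K := rfl

lemma isTwoECSS_iff : IsTwoECSS G H ↔ H ⊆ G.edgeSet ∧ Connected (G.restrict H) ∧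
    ∀ e ∈ H, Connected (G.restrict (H \ {e})) :=
  and_congr_right fun h => twoEdgeConnected_restrict_iff h

lemma isTwoECSS_contract_iff : IsTwoECSS (contract G K) H ↔ H ⊆ G.edgeSet \ K ∧
    Connected (G.restrict (K ∪ H)) ∧ ∀ e ∈ H, Connected (G.restrict (K ∪ H \ {e})) := by
  simp only [isTwoECSS_iff, connected_contract_iff, edgeSet_contract]

/-- Only minimality needs an argument: if `g` were redundant in the new tree, exchanging `e` back
for `f` would make it redundant in `T`. -/
lemma IsSpanningTree.swap (hT : IsSpanningTree G T) (hf : f ∈ T) (he : e ∈ G.edgeSet)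
    (heT : e ∉ T) (hc : Connected (G.restrict (insert e (T \ {f})))) :
    IsSpanningTree G (insert e (T \ {f})) := by
  refine ⟨Set.insert_subset he (Set.sdiff_subset.trans hT.1), hc, fun g hg hcg => ?_⟩
  by_cases hge : g = e
  · subst hge
    exact hT.2.2 f hf (hcg.mono (by intro z hz; exact hz.1.resolve_left hz.2))
  have hgT : g ∈ T \ {f} := hg.resolve_left hge
  obtain ⟨x, y, hl⟩ := G.exists_isLink_of_mem_edgeSet (hT.1 hf)
  obtain ⟨u, v, hl'⟩ := G.exists_isLink_of_mem_edgeSet he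
  have hn : ¬ Joined G ((T \ {f}) \ {g}) x y := by
    intro hj
    refine hT.2.2 f hf (hT.2.1.lift fun q hq a b hab => ?_)
    by_cases hqf : q = f
    · subst hqf
      have hj' := hj.mono (Set.sdiff_subset : _ ⊆ T \ {q})
      rcases hl.eq_and_eq_or_eq_and_eq hab with ⟨rfl, rfl⟩ | ⟨rfl, rfl⟩
      exacts [hj', hj'.symm]
    · exact .of_isLink ⟨hq, hqf⟩ hab
  have hsub : insert e (T \ {f}) \ {g} ⊆ insert e ((T \ {f}) \ {g}) := by
    rintro z ⟨rfl | hz, hz'⟩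
    · exact .inl rfl
    · exact .inr ⟨hz, hz'⟩
  have hsub' : insert f ((T \ {f}) \ {g}) ⊆ T \ {g} := by
    rintro z (rfl | hz)
    · exact ⟨hf, fun h => hgT.2 h.symm⟩
    · exact ⟨hz.1.1, hz.2⟩
  have hj : Joined G (T \ {g}) u v :=
    (Joined.exchange hl' hl ((hcg.joined hl).mono hsub) hn).mono hsub'
  refine hT.2.2 g hgT.1 (hcg.lift fun q hq a b hab => ?_)
  rcases hsub hq with rfl | hq
  · rcases hl'.eq_and_eq_or_eq_and_eq hab with ⟨rfl, rfl⟩ | ⟨rfl, rfl⟩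
    exacts [hj, hj.symm]
  · exact .of_isLink ⟨hq.1.1, hq.2⟩ hab

lemma Connected.exists_isSpanningTree [Finite β] (h : Connected (G.restrict X))
    (hX : X ⊆ G.edgeSet) : ∃ T ⊆ X, IsSpanningTree G T := by
  obtain ⟨T, hTX, hT⟩ :=
    (Set.toFinite {T : Set β | Connected (G.restrict T)}).exists_le_minimal h
  exact ⟨T, hTX, hTX.trans hX, hT.prop, fun e he hc => (hT.le_of_le hc Set.sdiff_subset he).2 rfl⟩

end Graph

/-! ### Weights of edge sets. -/

section Cost

variable {β : Type*} [Fintype β] {w : β → ℝ} {X Y : Set β} {e f : β}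

lemma cost_mono (hw : ∀ e ∈ Y, 0 ≤ w e) (h : X ⊆ Y) : cost w X ≤ cost w Y := by
  refine Finset.sum_le_sum fun e _ => ?_
  by_cases heY : e ∈ Y
  · by_cases heX : e ∈ X <;> simp [heX, heY, hw e heY]
  · have heX : e ∉ X := fun heX => heY (h heX)
    simp [heX, heY]

lemma cost_nonneg (hw : ∀ e ∈ X, 0 ≤ w e) : 0 ≤ cost w X :=
  Finset.sum_nonneg fun _ _ => Set.indicator_apply_nonneg (hw _)

lemma cost_union_le (hw : ∀ e ∈ X ∪ Y, 0 ≤ w e) : cost w (X ∪ Y) ≤ cost w X + cost w Y := by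
  unfold cost
  rw [← Finset.sum_add_distrib]
  refine Finset.sum_le_sum fun e _ => ?_
  by_cases heX : e ∈ X <;> by_cases heY : e ∈ Y <;> simp [heX, heY]
  exact hw e (.inl heX)

lemma cost_union (h : Disjoint X Y) : cost w (X ∪ Y) = cost w X + cost w Y := by
  unfold cost
  rw [Set.indicator_union_of_disjoint h, ← Finset.sum_add_distrib]

lemma cost_diff_add_cost (h : X ⊆ Y) : cost w (Y \ X) + cost w X = cost w Y := by
  rw [← cost_union Set.disjoint_sdiff_left, Set.sdiff_union_of_subset h]

lemma cost_singleton : cost w {e} = w e := by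
  classical
  unfold cost
  rw [Finset.sum_eq_single e] <;> simp +contextual

lemma cost_swap (he : e ∈ X) (hf : f ∉ X) :
    cost w (insert f (X \ {e})) = cost w X - w e + w f := by
  have h1 : Disjoint {f} (X \ {e}) := by
    rw [Set.disjoint_singleton_left]; exact fun h => hf h.1
  have h2 := cost_diff_add_cost (w := w) (Set.singleton_subset_iff.2 he)
  rw [Set.insert_eq, cost_union h1, cost_singleton]
  rw [cost_singleton] at h2
  linarith

end Cost

/-! ### Selected minimum spanning trees and upper thresholds. -/

/-- The position of an edge in the order by weight, with ties broken by `p`. -/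
def rank {E : Type*} (w p : E → ℝ) (e : E) : ℝ ×ₗ ℝ := toLex (w e, p e)

lemma rank_lt_iff {E : Type*} {w p : E → ℝ} {e f : E} :
    rank w p e < rank w p f ↔ w e < w f ∨ w e = w f ∧ p e < p f :=
  Prod.Lex.toLex_lt_toLex

namespace Instance

variable {V E : Type*} {I : Instance V E} {p : E → ℝ} {a : ℝ} {T : Set E} {e f : E}

lemma scaledWeight_of_safe (he : e ∈ I.safe) : I.scaledWeight a e = a * I.weight e := if_pos he

lemma scaledWeight_of_notMem (he : e ∉ I.safe) : I.scaledWeight a e = I.weight e := if_neg he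

lemma mem_unsafeEdges_or (he : e ∈ I.graph.edgeSet) : e ∈ I.safe ∨ e ∈ I.unsafeEdges := by
  by_cases h : e ∈ I.safe
  exacts [.inl h, .inr ⟨he, h⟩]

variable [Fintype E]

lemma exists_isSelectedMST (I : Instance V E) (p : E → ℝ) (a : ℝ) :
    ∃ T, I.IsSelectedMST p a T := by
  have h0 : Connected (I.graph.restrict I.graph.edgeSet) := by
    rw [Graph.restrict_self]
    exact I.connected
  obtain ⟨T₀, -, hT₀⟩ := h0.exists_isSpanningTree subset_rfl
  obtain ⟨T₁, hT₁, h₁⟩ := Set.exists_min_image {T | IsSpanningTree I.graph T}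
    (cost (I.scaledWeight a)) (Set.toFinite _) ⟨T₀, hT₀⟩
  obtain ⟨T, hT, h⟩ := Set.exists_min_image {T | I.IsAlphaMST a T}
    (cost p) (Set.toFinite _) ⟨T₁, hT₁, h₁⟩
  exact ⟨T, hT, h⟩

lemma IsSelectedMST.rank_lt (hp : I.IsTieBreaking p) (hT : I.IsSelectedMST p a T) (hf : f ∈ T)
    (he : e ∈ I.graph.edgeSet) (heT : e ∉ T)
    (hc : Connected (I.graph.restrict (insert e (T \ {f})))) :
    rank (I.scaledWeight a) p f < rank (I.scaledWeight a) p e := by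
  have hT' := hT.1.1.swap hf he heT hc
  have h1 := hT.1.2 _ hT'
  rw [cost_swap hf heT] at h1
  rw [rank_lt_iff]
  rcases (show I.scaledWeight a f ≤ I.scaledWeight a e by linarith).lt_or_eq with h | h
  · exact .inl h
  refine .inr ⟨h, ?_⟩
  -- At equal scaled weight the exchanged tree is again an α-MST, so the priorities decide.
  have h2 := hT.2 (insert e (T \ {f})) ⟨hT', fun T'' hT'' => by
    have := hT.1.2 T'' hT''
    rw [cost_swap hf heT]
    linarith⟩
  rw [cost_swap hf heT] at h2
  refine (show p f ≤ p e by linarith).lt_of_ne fun hpe => heT ?_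
  rwa [← hp.1 (hT.1.1.1 hf) he hpe]

/-- The cycle that `e` closes with `T` crosses the cut a second time, and `e` has the largest rank
on this cycle. -/
lemma IsSelectedMST.exists_crosses {U : Set V} (hp : I.IsTieBreaking p)
    (hT : I.IsSelectedMST p a T) (heT : e ∉ T) (he : Crosses I.graph U e) :
    ∃ f ∈ T, Crosses I.graph U f ∧ rank (I.scaledWeight a) p f < rank (I.scaledWeight a) p e := by
  obtain ⟨x, hx, y, hy, hl⟩ := he
  obtain ⟨B, hBT, hB, hmin⟩ := (hT.1.1.2.1.joined hl).exists_minimal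
  obtain ⟨f, hf, hfU⟩ := hB.exists_crosses hx hy
  refine ⟨f, hBT hf, hfU, hT.rank_lt hp (hBT hf) hl.edge_mem heT ?_⟩
  refine hT.1.1.2.1.lift fun q hq u v hl' => ?_
  by_cases hqf : q = f
  · subst hqf
    exact (hB.of_minimal hmin hf hl hl').mono
      (Set.insert_subset_insert (Set.sdiff_subset_sdiff_left hBT))
  · exact .of_isLink (.inr ⟨hq, hqf⟩) hl'

lemma IsSelectedMST.exists_cut (hp : I.IsTieBreaking p)
    (hT : I.IsSelectedMST p a T) (heT : e ∈ T) : ∃ U, Crosses I.graph U e ∧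
    ∀ f, Crosses I.graph U f →
      f = e ∨ rank (I.scaledWeight a) p e < rank (I.scaledWeight a) p f := by
  obtain ⟨U, he, hU⟩ := hT.1.1.2.1.exists_cut (hT.1.1.2.2 e heT)
  refine ⟨U, he, fun f hf => or_iff_not_imp_left.2 fun hfe => ?_⟩
  have hf' := hf
  obtain ⟨x, -, y, -, hl⟩ := hf'
  exact hT.rank_lt hp heT hl.edge_mem (fun h => hfe (hU f h hf)) (hT.1.1.2.1.swap hU hf)

/-- The upper threshold of a safe edge. -/
noncomputable def upperThreshold (I : Instance V E) (p : E → ℝ) (e : E) : ℝ :=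
  sSup (I.selectedFactors p e)

lemma upperThreshold_nonneg (I : Instance V E) (p : E → ℝ) (e : E) : 0 ≤ I.upperThreshold p e :=
  Real.sSup_nonneg fun _ h => h.1.1

lemma upperThreshold_le_one (I : Instance V E) (p : E → ℝ) (e : E) : I.upperThreshold p e ≤ 1 :=
  Real.sSup_le (fun _ h => h.1.2) zero_le_one

lemma upperThreshold_mem_thresholdValues (he : e ∈ I.safe) :
    I.upperThreshold p e ∈ I.thresholdValues p := ⟨e, .inl ⟨he, rfl⟩⟩

lemma IsSelectedMST.le_upperThreshold (hT : I.IsSelectedMST p a T) (ha : a ∈ Set.Icc (0 : ℝ) 1)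
    (he : e ∈ T) : a ≤ I.upperThreshold p e :=
  le_csSup ⟨1, fun _ h => h.1.2⟩ ⟨ha, T, hT, he⟩

lemma IsSelectedMST.mem_of_le_upperThreshold (hp : I.IsTieBreaking p)
    (hT : I.IsSelectedMST p a T) (ha : 0 < a) (he : e ∈ I.safe)
    (hae : a ≤ I.upperThreshold p e) : e ∈ T := by
  by_contra heT
  -- As there are finitely many edges, some `b < a` preserves all strict inequalities `I.weight f <
  -- a * I.weight e`.
  have hev : ∀ᶠ b in nhdsWithin a (Set.Iio a), ∀ f, I.weight f < a * I.weight e →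
      I.weight f < b * I.weight e := by
    refine Filter.eventually_all.2 fun f => ?_
    by_cases hf : I.weight f < a * I.weight e
    · have : Filter.Tendsto (fun b => b * I.weight e) (nhdsWithin a (Set.Iio a))
          (nhds (a * I.weight e)) :=
        (Continuous.tendsto (by fun_prop) a).mono_left nhdsWithin_le_nhds
      filter_upwards [this.eventually (lt_mem_nhds hf)] with b hb _ using hb
    · exact .of_forall fun b h => absurd h hf
  have hpos : ∀ᶠ b in nhdsWithin a (Set.Iio a), 0 < b :=
    nhdsWithin_le_nhds (lt_mem_nhds ha)
  obtain ⟨b, ⟨hb, hb0⟩, hba⟩ :=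
    ((hev.and hpos).and self_mem_nhdsWithin).exists
  -- The default `sSup ∅ = 0` is excluded by `0 < a`.
  have hne : (I.selectedFactors p e).Nonempty := by
    by_contra hne
    rw [Set.not_nonempty_iff_eq_empty] at hne
    rw [upperThreshold, hne, Real.sSup_empty] at hae
    linarith
  obtain ⟨c, ⟨-, T', hT', heT'⟩, hbc⟩ :=
    exists_lt_of_lt_csSup hne (show b < sSup (I.selectedFactors p e) from lt_of_lt_of_le hba hae)
  have hw : 0 ≤ I.weight e := I.weight_nonneg e (I.safe_subset he)
  have hc0 : 0 < c := hb0.trans hbc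
  obtain ⟨U, heU, hU⟩ := hT'.exists_cut hp heT'
  obtain ⟨f, hfT, hfU, hfe⟩ := hT.exists_crosses hp heT heU
  have hef := (hU f hfU).resolve_left (fun h => heT (h ▸ hfT))
  rw [rank_lt_iff] at hfe hef
  rw [scaledWeight_of_safe he] at hfe hef
  rcases mem_unsafeEdges_or (hT.1.1.1 hfT) with hf | hf
  -- Two safe edges compare in the same way at all positive factors.
  · rw [scaledWeight_of_safe hf] at hfe hef
    simp only [mul_lt_mul_iff_right₀ ha, mul_lt_mul_iff_right₀ hc0, mul_right_inj' ha.ne',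
      mul_right_inj' hc0.ne'] at hfe hef
    rcases hfe with hfe | hfe <;> rcases hef with hef | hef <;> linarith
  -- A tie would favour the safe edge `e`. So `f` is strictly lighter at `a`, hence at `b`, hence at
  -- `c > b`.
  · rw [scaledWeight_of_notMem hf.2] at hfe hef
    have hpf := hp.2 e he f hf
    have h1 : I.weight f < a * I.weight e := by
      rcases hfe with h | h <;> linarith
    have h2 := hb f h1
    have h3 : b * I.weight e ≤ c * I.weight e := mul_le_mul_of_nonneg_right hbc.le hw
    rcases hef with h | h <;> linarith

/-- For `a > 0`, the safe edges of the selected `a`-MST are those of upper threshold at least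
`a`. -/
lemma IsSelectedMST.inter_safe_eq (hp : I.IsTieBreaking p) (hT : I.IsSelectedMST p a T)
    (ha : 0 < a) (ha1 : a ≤ 1) : T ∩ I.safe = {e ∈ I.safe | a ≤ I.upperThreshold p e} := by
  ext e
  exact ⟨fun h => ⟨h.2, hT.le_upperThreshold ⟨ha.le, ha1⟩ h.1⟩,
    fun h => ⟨hT.mem_of_le_upperThreshold hp ha h.1 h.2, h.1⟩⟩

/-- The minimum weight of a spanning tree for the weights scaled by `a`. -/
noncomputable def mstCost (I : Instance V E) (p : E → ℝ) (a : ℝ) : ℝ :=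
  cost (I.scaledWeight a) (I.exists_isSelectedMST p a).choose

lemma mstCost_le (hT : IsSpanningTree I.graph T) : I.mstCost p a ≤ cost (I.scaledWeight a) T :=
  (I.exists_isSelectedMST p a).choose_spec.1.2 T hT

lemma IsSelectedMST.cost_eq (hT : I.IsSelectedMST p a T) :
    cost (I.scaledWeight a) T = I.mstCost p a :=
  le_antisymm (hT.1.2 _ (I.exists_isSelectedMST p a).choose_spec.1.1) (mstCost_le hT.1.1)

lemma cost_scaledWeight (I : Instance V E) (a : ℝ) (T : Set E) : cost (I.scaledWeight a) T =
    cost I.weight (T \ I.safe) + a * cost I.weight (T ∩ I.safe) := by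
  unfold cost
  rw [Finset.mul_sum, ← Finset.sum_add_distrib]
  refine Finset.sum_congr rfl fun e _ => ?_
  by_cases h1 : e ∈ T <;> by_cases h2 : e ∈ I.safe <;>
    simp [h1, h2, scaledWeight_of_safe, scaledWeight_of_notMem]

lemma mstCost_zero_nonneg (I : Instance V E) (p : E → ℝ) : 0 ≤ I.mstCost p 0 := by
  obtain ⟨T, hT⟩ := I.exists_isSelectedMST p 0
  rw [← hT.cost_eq, cost_scaledWeight, zero_mul, add_zero]
  exact cost_nonneg fun e he => I.weight_nonneg e (hT.1.1.1 he.1)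

/-- `T` competes at the factor `b` too; this is the supergradient inequality for the concave
function `mstCost`. -/
lemma IsSelectedMST.mul_cost_le (hT : I.IsSelectedMST p a T) (b : ℝ) :
    (a - b) * cost I.weight (T ∩ I.safe) ≤ I.mstCost p a - I.mstCost p b := by
  have h1 := hT.cost_eq
  have h2 := mstCost_le (p := p) (a := b) hT.1.1
  rw [cost_scaledWeight] at h1 h2
  linarith

lemma mstCost_one_le {X : Set E} (hX : X ⊆ I.graph.edgeSet)
    (hc : Connected (I.graph.restrict X)) : I.mstCost p 1 ≤ cost I.weight X := by
  obtain ⟨T, hTX, hT⟩ := hc.exists_isSpanningTree hX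
  refine (mstCost_le hT).trans ?_
  rw [cost_scaledWeight, one_mul, ← cost_union (by
    exact Set.disjoint_left.2 fun e h h' => h.2 h'.2), Set.sdiff_union_inter]
  exact cost_mono (fun e he => I.weight_nonneg e (hX he)) hTX

end Instance
-- Feasibility, safe bridges and their replacement by unsafe edges.
namespace Instance

variable {V E : Type*} {I : Instance V E} {p : E → ℝ} {S Z K H T L : Set E} {e f : E}

/-- The safe edges of `Z` whose deletion disconnects `Z`. -/
def safeBridges (I : Instance V E) (Z : Set E) : Set E :=
  {s ∈ Z | s ∈ I.safe ∧ ¬ Connected (I.graph.restrict (Z \ {s}))}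

lemma safeBridges_subset : I.safeBridges Z ⊆ Z := fun _ h => h.1

lemma safeBridges_subset_safe : I.safeBridges Z ⊆ I.safe := fun _ h => h.2.1

lemma IsFeasible.connected_diff (hZ : I.IsFeasible Z) (he : e ∈ Z) (heS : e ∉ I.safeBridges Z) :
    Connected (I.graph.restrict (Z \ {e})) := by
  by_contra hc
  rcases mem_unsafeEdges_or (hZ.1 he) with h | h
  · exact heS ⟨he, h, hc⟩
  · exact hc (hZ.2.2 e h)

lemma isFeasible_of_isTwoECSS_contract (hK : K ⊆ I.safe)
    (hH : IsTwoECSS (contract I.graph K) H) : I.IsFeasible (K ∪ H) := by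
  obtain ⟨hHE, hc, hd⟩ := isTwoECSS_contract_iff.1 hH
  refine ⟨Set.union_subset (hK.trans I.safe_subset) (hHE.trans Set.sdiff_subset), hc,
    fun f hf => ?_⟩
  by_cases hfH : f ∈ H
  · refine (hd f hfH).mono ?_
    rintro x (hx | hx)
    · exact ⟨.inl hx, fun h => hf.2 (hK (h ▸ hx))⟩
    · exact ⟨.inr hx.1, hx.2⟩
  · refine hc.mono fun x hx => ⟨hx, ?_⟩
    rintro rfl
    exact hx.elim (fun h => hf.2 (hK h)) hfH

variable [Fintype E]

/-- Each removed unsafe edge has a parallel safe edge that stays, and safe edges do not fail. -/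
lemma IsOutputA.isFeasible {lam : ℝ} (hZ : I.IsOutputA lam Z) : I.IsFeasible Z := by
  obtain ⟨H, ⟨hH, -⟩, rfl⟩ := hZ
  obtain ⟨hHE, hc, hd⟩ := isTwoECSS_iff.1 hH
  set Z : Set E := {e ∈ H | ¬ (e ∈ I.unsafeEdges ∧ ∃ f ∈ H, f ∈ I.safe ∧ I.Parallel e f)} with hZ
  have key : ∀ e ∈ H, e ∈ Z ∨ ∃ f ∈ Z, f ∈ I.safe ∧ I.Parallel e f := by
    intro e he
    by_cases h : e ∈ I.unsafeEdges ∧ ∃ f ∈ H, f ∈ I.safe ∧ I.Parallel e f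
    · obtain ⟨-, f, hf, hfs, hef⟩ := h
      exact .inr ⟨f, ⟨hf, fun h => h.1.2 hfs⟩, hfs, hef⟩
    · exact .inl ⟨he, h⟩
  have key' : ∀ g ∉ I.safe, Connected (I.graph.restrict (H \ {g})) →
      Connected (I.graph.restrict (Z \ {g})) := by
    intro g hg hcg
    refine hcg.lift fun e he x y hl => ?_
    rcases key e he.1 with h | ⟨f, hf, hfs, u, v, hu, hv⟩
    · exact .of_isLink ⟨h, he.2⟩ hl
    · have hfg : f ∈ Z \ {g} := ⟨hf, fun h => hg (h ▸ hfs)⟩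
      rcases hu.eq_and_eq_or_eq_and_eq hl with ⟨rfl, rfl⟩ | ⟨rfl, rfl⟩
      · exact .of_isLink hfg hv
      · exact .of_isLink hfg hv.symm
  refine ⟨fun e he => hHE he.1, ?_, fun g hg => key' g hg.2 ?_⟩
  · refine hc.lift fun e he x y hl => ?_
    rcases key e he with h | ⟨f, hf, hfs, u, v, hu, hv⟩
    · exact .of_isLink h hl
    · rcases hu.eq_and_eq_or_eq_and_eq hl with ⟨rfl, rfl⟩ | ⟨rfl, rfl⟩
      · exact .of_isLink hf hv
      · exact .of_isLink hf hv.symm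
  · by_cases hgH : g ∈ H
    · exact hd g hgH
    · rwa [Set.sdiff_singleton_eq_self hgH]

lemma IsOutputB.isFeasible {tau : ℝ} (hT : T ⊆ I.graph.edgeSet) (hZ : I.IsOutputB tau T Z) :
    I.IsFeasible Z := by
  obtain ⟨L, ⟨⟨hL, hc⟩, -⟩, rfl⟩ := hZ
  have h : IsTwoECSS (contract I.graph (T ∩ I.safe)) (T \ I.safe ∪ L) := by
    refine ⟨Set.union_subset ?_ (hL.trans Set.sdiff_subset), hc⟩
    rintro e ⟨he, hes⟩
    exact ⟨hT he, fun h => hes h.2⟩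
  have := isFeasible_of_isTwoECSS_contract Set.inter_subset_right h
  rwa [← Set.union_assoc, Set.inter_union_sdiff] at this

lemma IsOutputC.isFeasible {lam : ℝ} (hZ : I.IsOutputC lam T Z) : I.IsFeasible Z := by
  obtain ⟨H, ⟨hH, -⟩, rfl⟩ := hZ
  exact isFeasible_of_isTwoECSS_contract Set.inter_subset_right hH

lemma IsOptimal.exists_min_priority (hZ : I.IsOptimal Z) (p : E → ℝ) :
    ∃ Z', I.IsOptimal Z' ∧ ∀ Z'', I.IsOptimal Z'' → cost p Z' ≤ cost p Z'' :=
  Set.exists_min_image {Z | I.IsOptimal Z} (cost p) (Set.toFinite _) ⟨Z, hZ⟩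

/-- In an optimal solution of minimum priority, safe bridges cannot be exchanged for smaller safe
edges. -/
lemma IsOptimal.exists_crosses (hZ : I.IsOptimal Z)
    (hmin : ∀ Z', I.IsOptimal Z' → cost p Z ≤ cost p Z') (hf : f ∈ I.safe) {U : Set V}
    (hfU : Crosses I.graph U f) : ∃ s ∈ Z, Crosses I.graph U s ∧
      (s ∈ I.safeBridges Z → rank I.weight p s ≤ rank I.weight p f) := by
  obtain ⟨x, hx, y, hy, hl⟩ := hfU
  obtain ⟨B, hBZ, hB, hBmin⟩ := (hZ.1.2.1.joined hl).exists_minimal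
  obtain ⟨s, hs, hsU⟩ := hB.exists_crosses hx hy
  refine ⟨s, hBZ hs, hsU, fun hsS => ?_⟩
  by_contra! hlt
  have hc : Connected (I.graph.restrict (insert f (Z \ {s}))) := by
    refine hZ.1.2.1.lift fun q hq u v hl' => ?_
    by_cases hqs : q = s
    · subst hqs
      exact (hB.of_minimal hBmin hs hl hl').mono
        (Set.insert_subset_insert (Set.sdiff_subset_sdiff_left hBZ))
    · exact .of_isLink (.inr ⟨hq, hqs⟩) hl'
  obtain ⟨U', hsU', hU'⟩ := hZ.1.2.1.exists_cut hsS.2.2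
  have hfU' : Crosses I.graph U' f := by
    obtain ⟨q, rfl | hq, hqU⟩ := hc.exists_mem_crosses hsU'
    · exact hqU
    · exact absurd (hU' q hq.1 hqU) hq.2
  have hfZ : f ∉ Z := by
    intro h
    rw [hU' f h hfU'] at hlt
    exact lt_irrefl _ hlt
  -- As `s` is the only edge of `Z` across `U'`, the safe edge `f` takes its place also after the
  -- failure of an unsafe `g`.
  have hfeas : I.IsFeasible (insert f (Z \ {s})) := by
    refine ⟨Set.insert_subset hl.edge_mem (Set.sdiff_subset.trans hZ.1.1), hc, fun g hg => ?_⟩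
    refine ((hZ.1.2.2 g hg).swap (fun q hq hqU => hU' q hq.1 hqU) hfU').mono ?_
    rintro z (rfl | hz)
    · exact ⟨.inl rfl, fun h => hg.2 (h ▸ hf)⟩
    · exact ⟨.inr ⟨hz.1.1, hz.2⟩, hz.1.2⟩
  have h1 := hZ.2 _ hfeas
  rw [cost_swap hsS.1 hfZ] at h1
  rw [rank_lt_iff] at hlt
  rcases hlt with h | ⟨hw, hpf⟩
  · linarith
  have h2 := hmin (insert f (Z \ {s})) ⟨hfeas, fun Z' hZ' => by
    rw [cost_swap hsS.1 hfZ, hw]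
    linarith [hZ.2 Z' hZ']⟩
  rw [cost_swap hsS.1 hfZ] at h2
  linarith

/-- Every safe edge that crosses a cut is at least as large as some edge of `S`, or the cut is
crossed by an edge of `Z` outside `S`. -/
def SafeMinimal (I : Instance V E) (p : E → ℝ) (Z S : Set E) : Prop :=
  ∀ f ∈ I.safe, ∀ U, Crosses I.graph U f → ∃ s ∈ Z, Crosses I.graph U s ∧
    (s ∈ S → rank I.weight p s ≤ rank I.weight p f)

/-- Just above the threshold of `e`, no edge of `S` across the cut is selected any more. Minimality
of `Z` prevents a safe edge from being the reason, so a cheap unsafe edge crosses. -/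
lemma SafeMinimal.exists_unsafe_crosses (hmin : I.SafeMinimal p Z S) (hcopies : I.HasUnsafeCopies)
    (hp : I.IsTieBreaking p) (hS : S ⊆ I.safe) (he : e ∈ S) {U : Set V}
    (heU : Crosses I.graph U e) (hR : ∀ q ∈ Z \ S, ¬ Crosses I.graph U q)
    (hle : ∀ s ∈ S, Crosses I.graph U s → I.upperThreshold p s ≤ I.upperThreshold p e) :
    ∃ f ∈ I.unsafeEdges, Crosses I.graph U f ∧
      I.weight f ≤ I.upperThreshold p e * I.weight e := by
  -- At threshold 1 there is no larger factor in the unit interval; the unsafe copy of `e` serves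
  -- instead.
  rcases (I.upperThreshold_le_one p e).eq_or_lt with h1 | h1
  · obtain ⟨f, hf, ⟨u, v, hu, hv⟩, hw⟩ := hcopies e (hS he)
    refine ⟨f, hf, ?_, by rw [h1, hw, one_mul]⟩
    obtain ⟨x, hx, y, hy, hl⟩ := heU
    rcases hu.eq_and_eq_or_eq_and_eq hl with ⟨rfl, rfl⟩ | ⟨rfl, rfl⟩
    · exact ⟨_, hx, _, hy, hv⟩
    · exact ⟨_, hx, _, hy, hv.symm⟩
  -- A factor `a` so close above the threshold that `I.weight f ≤ a * I.weight e` already implies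
  -- the same bound at the threshold.
  have hev : ∀ᶠ b in nhdsWithin (I.upperThreshold p e) (Set.Ioi (I.upperThreshold p e)),
      ∀ f, I.upperThreshold p e * I.weight e < I.weight f → b * I.weight e < I.weight f := by
    refine Filter.eventually_all.2 fun f => ?_
    by_cases hf : I.upperThreshold p e * I.weight e < I.weight f
    · have : Filter.Tendsto (fun b => b * I.weight e)
          (nhdsWithin (I.upperThreshold p e) (Set.Ioi (I.upperThreshold p e)))
          (nhds (I.upperThreshold p e * I.weight e)) :=
        (Continuous.tendsto (by fun_prop) _).mono_left nhdsWithin_le_nhds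
      filter_upwards [this.eventually (gt_mem_nhds hf)] with b hb _ using hb
    · exact .of_forall fun b h => absurd h hf
  obtain ⟨a, ⟨ha, ha1⟩, hea⟩ := ((hev.and (nhdsWithin_le_nhds (gt_mem_nhds h1))).and
    self_mem_nhdsWithin).exists
  have hea : I.upperThreshold p e < a := hea
  have ha0 : 0 < a := (I.upperThreshold_nonneg p e).trans_lt hea
  obtain ⟨T, hT⟩ := I.exists_isSelectedMST p a
  -- With `u` of least rank, a safe tree edge of smaller rank would by `hmin` force an edge of `S`
  -- across `U` below `u`.
  obtain ⟨u, ⟨huS, huU, hue⟩, humin⟩ := Set.exists_min_image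
    {s | s ∈ S ∧ Crosses I.graph U s ∧ rank I.weight p s ≤ rank I.weight p e}
    (rank I.weight p) (Set.toFinite _) ⟨e, he, heU, le_rfl⟩
  have huT : u ∉ T := fun h => absurd (hT.le_upperThreshold ⟨ha0.le, ha1.le⟩ h)
    (not_le.2 ((hle u huS huU).trans_lt hea))
  obtain ⟨f, hfT, hfU, hfu⟩ := hT.exists_crosses hp huT huU
  have hwue : I.weight u ≤ I.weight e := by
    rcases hue.lt_or_eq with h | h
    · rcases rank_lt_iff.1 h with h | h
      exacts [h.le, h.1.le]
    · exact (congrArg (fun z => (ofLex z).1) h).le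
  rcases mem_unsafeEdges_or (hT.1.1.1 hfT) with hf | hf
  · have hlt : rank I.weight p f < rank I.weight p u := by
      rw [rank_lt_iff, scaledWeight_of_safe hf, scaledWeight_of_safe (hS huS),
        mul_lt_mul_iff_right₀ ha0, mul_right_inj' ha0.ne'] at hfu
      exact rank_lt_iff.2 hfu
    obtain ⟨s, hsZ, hsU, hsf⟩ := hmin f hf U hfU
    have hsS : s ∈ S := by
      by_contra h
      exact hR s ⟨hsZ, h⟩ hsU
    have hsu := (hsf hsS).trans_lt hlt
    exact absurd (humin s ⟨hsS, hsU, hsu.le.trans hue⟩) (not_le.2 hsu)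
  · refine ⟨f, hf, hfU, ?_⟩
    rw [rank_lt_iff, scaledWeight_of_notMem hf.2, scaledWeight_of_safe (hS huS)] at hfu
    have h2 : I.weight f ≤ a * I.weight u := by
      rcases hfu with h | h
      exacts [h.le, h.1.le]
    have h3 : a * I.weight u ≤ a * I.weight e := mul_le_mul_of_nonneg_left hwue ha0.le
    by_contra! h
    linarith [ha f h]

/-- The edges of `S'` can be replaced by unsafe edges of total weight at most the weight of `S'`
scaled by the thresholds. -/
lemma SafeMinimal.exists_replacement (hmin : I.SafeMinimal p Z S) (hcopies : I.HasUnsafeCopies)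
    (hp : I.IsTieBreaking p) (hS : S ⊆ I.safe) (n : ℕ) : ∀ S' R' : Set E, S'.ncard = n →
    S' ⊆ S → Z \ S ⊆ R' → (∀ s ∈ S, s ∉ R' → s ∉ S' → ∀ e ∈ S',
      I.upperThreshold p s ≤ I.upperThreshold p e) →
    Connected (I.graph.restrict (R' ∪ S')) → ∃ M ⊆ I.unsafeEdges,
      Connected (I.graph.restrict (R' ∪ M)) ∧
      cost I.weight M ≤ cost (fun e => I.upperThreshold p e * I.weight e) S' := by
  induction n with
  | zero =>
    intro S' R' hn _ _ _ hc
    rw [Set.ncard_eq_zero] at hn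
    subst hn
    exact ⟨∅, Set.empty_subset _, hc, by simp [cost]⟩
  | succ n ih =>
    intro S' R' hn hS' hR' hle hc
    have hne : S'.Nonempty := by
      rw [← Set.ncard_pos]
      omega
    obtain ⟨e, he, hemin⟩ := Set.exists_min_image S' (I.upperThreshold p) (Set.toFinite _) hne
    have hn' : (S' \ {e}).ncard = n := by
      rw [Set.ncard_sdiff_singleton_of_mem he, hn]
      rfl
    have hsub : S' \ {e} ⊆ S := Set.sdiff_subset.trans hS'
    have hle' : ∀ s ∈ S, s ∉ R' → s ∉ S' \ {e} → ∀ e' ∈ S' \ {e},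
        I.upperThreshold p s ≤ I.upperThreshold p e' := by
      intro s hs hsR hsS e' he'
      by_cases hse : s = e
      · subst hse
        exact hemin e' he'.1
      · exact hle s hs hsR (fun h => hsS ⟨h, hse⟩) e' he'.1
    have hcost : cost (fun e => I.upperThreshold p e * I.weight e) (S' \ {e}) +
        I.upperThreshold p e * I.weight e =
        cost (fun e => I.upperThreshold p e * I.weight e) S' := by
      rw [← cost_diff_add_cost (Set.singleton_subset_iff.2 he), cost_singleton]
    by_cases hce : Connected (I.graph.restrict ((R' ∪ S') \ {e}))
    · obtain ⟨M, hM, hMc, hMw⟩ := ih (S' \ {e}) R' hn' hsub hR' hle' (hce.mono (by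
        rintro x ⟨hx | hx, hxe⟩
        exacts [.inl hx, .inr ⟨hx, hxe⟩]))
      refine ⟨M, hM, hMc, hMw.trans ?_⟩
      have := mul_nonneg (I.upperThreshold_nonneg p e)
        (I.weight_nonneg e (I.safe_subset (hS (hS' he))))
      linarith
    · obtain ⟨U, heU, hU⟩ := hc.exists_cut hce
      obtain ⟨f, hf, hfU, hfw⟩ := hmin.exists_unsafe_crosses hcopies hp hS (hS' he) heU
        (fun q hq hqU => hq.2 (hU q (.inl (hR' hq)) hqU ▸ hS' he))
        (fun s hs hsU => by
          by_cases hsQ : s ∈ R' ∪ S'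
          · rw [hU s hsQ hsU]
          · rw [Set.mem_union, not_or] at hsQ
            exact hle s hs hsQ.1 hsQ.2 e he)
      obtain ⟨M, hM, hMc, hMw⟩ := ih (S' \ {e}) (insert f R') hn' hsub
        (hR'.trans (Set.subset_insert _ _))
        (fun s hs hsR => hle' s hs (fun h => hsR (.inr h)))
        ((hc.swap hU hfU).mono (by
          rintro x (rfl | ⟨hx | hx, hxe⟩)
          exacts [.inl (.inl rfl), .inl (.inr hx), .inr ⟨hx, hxe⟩]))
      refine ⟨{f} ∪ M, Set.union_subset (Set.singleton_subset_iff.2 hf) hM, ?_, ?_⟩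
      · refine hMc.mono ?_
        rintro x ((rfl | hx) | hx)
        exacts [.inr (.inl rfl), .inl hx, .inr (.inr hx)]
      · refine (cost_union_le fun x hx => I.weight_nonneg x ?_).trans ?_
        · rcases hx with rfl | hx
          exacts [hf.1, (hM hx).1]
        · rw [cost_singleton]
          linarith

/-- Contracting a set `K` of safe edges, the rest of a solution `Z` can be augmented to a
2-edge-connected spanning subgraph. -/
lemma SafeMinimal.exists_augmentation (hmin : I.SafeMinimal p Z (I.safeBridges Z))
    (hcopies : I.HasUnsafeCopies) (hp : I.IsTieBreaking p) (hZ : I.IsFeasible Z)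
    (hK : K ⊆ I.safe) : ∃ M ⊆ I.unsafeEdges,
      Connected (I.graph.restrict (Z \ I.safeBridges Z ∪ K ∪ M)) ∧
      IsTwoECSS (contract I.graph K) (Z \ K ∪ M) ∧
      cost I.weight M ≤ cost (fun e => I.upperThreshold p e * I.weight e)
        (I.safeBridges Z \ K) := by
  obtain ⟨M, hM, hMc, hMw⟩ := hmin.exists_replacement hcopies hp safeBridges_subset_safe _
    (I.safeBridges Z \ K) (Z \ I.safeBridges Z ∪ K) rfl Set.sdiff_subset Set.subset_union_left
    (fun s hs hsR hsS => absurd ⟨hs, fun h => hsR (.inr h)⟩ hsS)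
    (hZ.2.1.mono (by
      intro x hx
      by_cases hxK : x ∈ K
      · exact .inl (.inr hxK)
      · by_cases hxS : x ∈ I.safeBridges Z
        exacts [.inr ⟨hxS, hxK⟩, .inl (.inl ⟨hx, hxS⟩)]))
  refine ⟨M, hM, hMc, isTwoECSS_contract_iff.2 ⟨?_, ?_, ?_⟩, hMw⟩
  · rintro x (hx | hx)
    exacts [⟨hZ.1 hx.1, hx.2⟩, ⟨(hM hx).1, fun h => (hM hx).2 (hK h)⟩]
  · refine hZ.2.1.mono fun x hx => ?_
    by_cases hxK : x ∈ K
    exacts [.inl hxK, .inr (.inl ⟨hx, hxK⟩)]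
  · intro h hh
    -- If `h` is a safe bridge, `hMc` supplies a connected set avoiding it; any other edge can be
    -- deleted from `Z` itself.
    by_cases hhS : h ∈ I.safeBridges Z
    · have hhK : h ∉ K := by
        rcases hh with hh | hh
        exacts [hh.2, fun h' => (hM hh).2 (hK h')]
      refine hMc.mono ?_
      rintro x ((hx | hx) | hx)
      · by_cases hxK : x ∈ K
        exacts [.inl hxK, .inr ⟨.inl ⟨hx.1, hxK⟩, fun h => hx.2 (h ▸ hhS)⟩]
      · exact .inl hx
      · exact .inr ⟨.inr hx, fun h => (hM hx).2 (h ▸ hhS.2.1)⟩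
    · have hc : Connected (I.graph.restrict (Z \ {h})) := by
        by_cases hhZ : h ∈ Z
        · exact hZ.connected_diff hhZ hhS
        · rw [Set.sdiff_singleton_eq_self hhZ]
          exact hZ.2.1
      refine hc.mono fun x hx => ?_
      by_cases hxK : x ∈ K
      exacts [.inl hxK, .inr ⟨.inl ⟨hx.1, hxK⟩, hx.2⟩]

end Instance

/-! ### The maximization problem. -/

section Problem

variable {N : ℕ} {lam : ℝ}

lemma exists_isGreatest_problemValues (hN : 1 ≤ N) :
    lam ∈ problemValues N lam ∧ ∃ rho, IsGreatest (problemValues N lam) rho := by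
  have h0 : lam ∈ problemValues N lam := by
    refine ⟨0, Pi.single ⟨0, hN⟩ 1, by simp, monotone_const, by simp, fun j => ?_, by simp⟩
    by_cases h : j = ⟨0, hN⟩
    · subst h; simp
    · simp [Pi.single_eq_of_ne h]
  refine ⟨h0, ?_⟩
  let C : Set ((Fin N → ℝ) × (Fin N → ℝ)) :=
    (Set.univ.pi fun _ => Set.Icc 0 1) ×ˢ (Set.univ.pi fun _ => Set.Icc 0 1)
  let D : Set ((Fin N → ℝ) × (Fin N → ℝ)) :=
    {x | ∑ j, x.2 j * (1 + x.1 j * (lam - 1 + lam * x.1 j)) = 1} ∩ {x | Monotone x.1}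
  have hC : IsCompact C := (isCompact_univ_pi fun _ => isCompact_Icc).prod
    (isCompact_univ_pi fun _ => isCompact_Icc)
  have hD : IsClosed D := by
    refine (isClosed_eq (by fun_prop) continuous_const).inter ?_
    simp only [Monotone, Set.ofPred_forall]
    exact isClosed_iInter fun i => isClosed_iInter fun j => isClosed_iInter fun _ =>
      isClosed_le (by fun_prop) (by fun_prop)
  have himage : problemValues N lam = (fun x : (Fin N → ℝ) × (Fin N → ℝ) =>
      lam * (1 + ∑ j, x.1 j * x.2 j)) '' (C ∩ D) := by
    ext x
    constructor
    · rintro ⟨a, b, h1, h2, h3, h4, rfl⟩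
      exact ⟨(a, b), ⟨⟨fun j _ => h3 j, fun j _ => h4 j⟩, h1, h2⟩, rfl⟩
    · rintro ⟨⟨a, b⟩, ⟨⟨h3, h4⟩, h1, h2⟩, rfl⟩
      exact ⟨a, b, h1, h2, fun j => h3 j trivial, fun j => h4 j trivial, rfl⟩
  have hcomp : IsCompact (problemValues N lam) := by
    rw [himage]
    exact (hC.inter_right hD).image (by fun_prop)
  exact hcomp.exists_isGreatest ⟨_, h0⟩

lemma exists_monotone_enumeration {s : Set ℝ} (hs : s.encard ≤ N)
    (h01 : s ⊆ Set.Icc 0 1) : ∃ a : Fin N → ℝ, Monotone a ∧ (∀ j, a j ∈ Set.Icc (0 : ℝ) 1) ∧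
      ∀ t ∈ s, ∃ j, a j = t := by
  rcases s.eq_empty_or_nonempty with rfl | hne
  · exact ⟨0, monotone_const, by simp, by simp⟩
  have hfin : s.Finite := Set.finite_of_encard_le_coe hs
  have : Fintype s := hfin.fintype
  have : Nonempty s := hne.to_subtype
  have hcard : Fintype.card s ≤ Fintype.card (Fin N) := by
    rw [Fintype.card_fin]
    have : s.encard = (Fintype.card s : ℕ∞) := by
      rw [Set.encard, ENat.card_eq_coe_fintype_card]
    rw [this] at hs
    exact_mod_cast hs
  obtain ⟨i⟩ := Function.Embedding.nonempty_of_card_le hcard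
  -- A left inverse of the embedding is onto `s`; values repeat when `s` has fewer than `N`
  -- elements.
  let a : Fin N → ℝ := fun j => (Function.invFun i j : s)
  refine ⟨a ∘ Tuple.sort a, Tuple.monotone_sort a, fun j => h01 (Subtype.prop _), fun t ht => ?_⟩
  refine ⟨(Tuple.sort a).symm (i ⟨t, ht⟩), ?_⟩
  simp [a, Function.leftInverse_invFun i.injective _]

/-- A weighted set of edges with parameters among `N` values in `[0, 1]` gives a feasible point of
the maximization problem. -/
lemma mem_problemValues {E : Type*} [Fintype E] (hlam : 1 ≤ lam) {w θ : E → ℝ} {S : Set E}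
    (hw : ∀ e ∈ S, 0 ≤ w e) (hN : 1 ≤ N) (hθ : (θ '' S).encard ≤ N)
    (h01 : ∀ e, θ e ∈ Set.Icc (0 : ℝ) 1) {σ : ℝ}
    (hσ : σ = cost (fun e => (1 + θ e * (lam - 1 + lam * θ e)) * w e) S) (hpos : 0 < σ) :
    lam * (1 + cost (fun e => θ e * w e) S / σ) ∈ problemValues N lam := by
  classical
  obtain ⟨a, ha, ha01, hsurj⟩ := exists_monotone_enumeration hθ (by
    rintro _ ⟨e, -, rfl⟩
    exact h01 e)
  have : ∀ e, ∃ j, e ∈ S → a j = θ e := by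
    intro e
    by_cases he : e ∈ S
    · obtain ⟨j, hj⟩ := hsurj _ ⟨e, he, rfl⟩
      exact ⟨j, fun _ => hj⟩
    · exact ⟨⟨0, hN⟩, fun h => absurd h he⟩
  choose idx hidx using this
  -- Each edge has a single index `idx e`, so repeated values of `a` count no edge twice.
  let b : Fin N → ℝ := fun j => (∑ e, if idx e = j then S.indicator w e else 0) / σ
  have hsum : ∀ g : ℝ → ℝ, ∑ j, b j * g (a j) = cost (fun e => g (θ e) * w e) S / σ := by
    intro g
    simp only [b, div_mul_eq_mul_div, ← Finset.sum_div, Finset.sum_mul]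
    rw [Finset.sum_comm]
    congr 1
    refine Finset.sum_congr rfl fun e _ => ?_
    simp only [ite_mul, zero_mul, Finset.sum_ite_eq, Finset.mem_univ, if_true]
    by_cases he : e ∈ S
    · simp [he, hidx e he, mul_comm]
    · simp [he]
  have hb0 : ∀ j, 0 ≤ b j := by
    intro j
    refine div_nonneg (Finset.sum_nonneg fun e _ => ?_) hpos.le
    split_ifs
    exacts [Set.indicator_apply_nonneg (hw e), le_rfl]
  have h1 : ∑ j, b j * (1 + a j * (lam - 1 + lam * a j)) = 1 := by
    rw [hsum fun t => 1 + t * (lam - 1 + lam * t), ← hσ, div_self hpos.ne']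
  have hc : ∀ j, 1 ≤ 1 + a j * (lam - 1 + lam * a j) := by
    intro j
    have h0 := (ha01 j).1
    have : 0 ≤ a j * (lam - 1 + lam * a j) :=
      mul_nonneg h0 (add_nonneg (by linarith) (mul_nonneg (by linarith) h0))
    linarith
  refine ⟨a, b, h1, ha, ha01, fun j => ⟨hb0 j, ?_⟩, ?_⟩
  -- All coefficients in the constraint are at least 1, so each `b j` is at most the whole sum.
  · have h2 : b j ≤ b j * (1 + a j * (lam - 1 + lam * a j)) :=
      le_mul_of_one_le_right (hb0 j) (hc j)
    have h3 := Finset.single_le_sum (f := fun j => b j * (1 + a j * (lam - 1 + lam * a j)))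
      (fun j _ => mul_nonneg (hb0 j) (by linarith [hc j])) (Finset.mem_univ j)
    simp only [h1] at h3
    linarith
  · rw [← hsum fun t => t]
    simp only [mul_comm]

end Problem

/-! ### Bounds for Algorithms A and C, and averaging over the scaling factors. -/

/-- If an increasing function grows by at least `z` times the step between consecutive points of a
finite set, it does so between `0` and any point of the set. -/
lemma mul_le_sub_of_consecutive {W : Set ℝ} (hW : W.Finite) (h0 : (0 : ℝ) ∈ W)
    (hW0 : ∀ t ∈ W, 0 ≤ t) {h : ℝ → ℝ} {z : ℝ}
    (hstep : ∀ s ∈ W, ∀ t ∈ W, s < t → (∀ x ∈ W, x < t → x ≤ s) → (t - s) * z ≤ h t - h s) :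
    ∀ t ∈ W, t * z ≤ h t - h 0 := by
  -- Compare the smallest violating `t` with its predecessor in `W`.
  by_contra! hc
  obtain ⟨t, ⟨ht, hlt⟩, hmin⟩ := Set.exists_min_image {t | t ∈ W ∧ h t - h 0 < t * z} id
    (hW.subset fun _ h => h.1) hc
  have htpos : 0 < t := (hW0 t ht).lt_of_ne fun h => by
    subst h
    simp at hlt
  obtain ⟨s, ⟨hs, hst⟩, hmax⟩ := Set.exists_max_image {s | s ∈ W ∧ s < t} id
    (hW.subset fun _ h => h.1) ⟨0, h0, htpos⟩
  have h1 := hstep s hs t ht hst fun x hx hxt => hmax x ⟨hx, hxt⟩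
  have h2 : s * z ≤ h s - h 0 := by
    by_contra! h
    exact absurd (hmin s ⟨hs, h⟩) (not_le.2 hst)
  linarith

namespace Instance

variable {V E : Type*} [Fintype E] {I : Instance V E} {p : E → ℝ} {Z Z' T : Set E} {lam : ℝ}

/-- Replacing all safe bridges leaves a connected set, which contains a spanning tree. -/
lemma mstCost_one_le_of_safeMinimal (hmin : I.SafeMinimal p Z (I.safeBridges Z))
    (hcopies : I.HasUnsafeCopies) (hp : I.IsTieBreaking p) (hZ : I.IsFeasible Z) :
    I.mstCost p 1 ≤ cost I.weight Z - cost I.weight (I.safeBridges Z) +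
      cost (fun e => I.upperThreshold p e * I.weight e) (I.safeBridges Z) := by
  obtain ⟨M, hM, hMc, -, hMw⟩ := hmin.exists_augmentation hcopies hp hZ (Set.empty_subset _)
  rw [Set.union_empty] at hMc
  rw [Set.sdiff_empty] at hMw
  have hsub : Z \ I.safeBridges Z ∪ M ⊆ I.graph.edgeSet :=
    Set.union_subset (Set.sdiff_subset.trans hZ.1) (hM.trans Set.sdiff_subset)
  have h1 := mstCost_one_le (p := p) hsub hMc
  have h2 := cost_union_le (w := I.weight) fun e he => I.weight_nonneg e (hsub he)
  have h3 := cost_diff_add_cost (w := I.weight) (safeBridges_subset (I := I) (Z := Z))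
  linarith

lemma IsOutputA.cost_le (hlam : 0 ≤ lam) (hA : I.IsOutputA lam Z')
    (hmin : I.SafeMinimal p Z (I.safeBridges Z))
    (hcopies : I.HasUnsafeCopies) (hp : I.IsTieBreaking p) (hZ : I.IsFeasible Z) :
    cost I.weight Z' ≤ lam * (cost I.weight Z +
      cost (fun e => I.upperThreshold p e * I.weight e) (I.safeBridges Z)) := by
  obtain ⟨M, hM, -, hMe, hMw⟩ := hmin.exists_augmentation hcopies hp hZ (Set.empty_subset _)
  simp only [isTwoECSS_contract_iff, Set.sdiff_empty, Set.empty_union] at hMe hMw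
  rw [← isTwoECSS_iff] at hMe
  obtain ⟨H, ⟨hH, hHmin⟩, rfl⟩ := hA
  have h1 : cost I.weight {e ∈ H | ¬ (e ∈ I.unsafeEdges ∧ ∃ f ∈ H, f ∈ I.safe ∧ I.Parallel e f)} ≤
      cost I.weight H := cost_mono (fun e he => I.weight_nonneg e (hH.1 he)) fun e he => he.1
  refine h1.trans ((hHmin _ hMe).trans (mul_le_mul_of_nonneg_left ?_ hlam))
  have h2 := cost_union_le (w := I.weight) fun e he => I.weight_nonneg e (hMe.1 he)
  linarith

/-- With `K = T ∩ I.safe`, the competitor of `H` is `Z \ K` together with the replacements of the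
safe bridges outside `K`. -/
lemma IsOutputC.cost_le (hlam : 0 ≤ lam) (hC : I.IsOutputC lam T Z')
    (hmin : I.SafeMinimal p Z (I.safeBridges Z))
    (hcopies : I.HasUnsafeCopies) (hp : I.IsTieBreaking p) (hZ : I.IsFeasible Z) :
    cost I.weight Z' ≤ cost I.weight (T ∩ I.safe) + lam * (cost I.weight Z -
      cost I.weight (I.safeBridges Z ∩ (T ∩ I.safe)) +
      cost (fun e => I.upperThreshold p e * I.weight e) (I.safeBridges Z \ (T ∩ I.safe))) := by
  obtain ⟨M, hM, -, hMe, hMw⟩ := hmin.exists_augmentation hcopies hp hZ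
    (Set.inter_subset_right : T ∩ I.safe ⊆ _)
  obtain ⟨H, ⟨hH, hHmin⟩, rfl⟩ := hC
  have hHE : H ⊆ I.graph.edgeSet := hH.1.trans Set.sdiff_subset
  have h1 := hHmin _ hMe
  have h2 : cost I.weight (Z \ (T ∩ I.safe) ∪ M) ≤ cost I.weight Z -
      cost I.weight (I.safeBridges Z ∩ (T ∩ I.safe)) +
      cost (fun e => I.upperThreshold p e * I.weight e) (I.safeBridges Z \ (T ∩ I.safe)) := by
    have h3 := cost_union_le (w := I.weight) fun e he =>
      I.weight_nonneg e (Set.sdiff_subset (hMe.1 he))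
    have h4 := cost_diff_add_cost (w := I.weight) (Y := Z)
      (Set.inter_subset_left.trans safeBridges_subset : I.safeBridges Z ∩ (T ∩ I.safe) ⊆ Z)
    have h5 : cost I.weight (Z \ (T ∩ I.safe)) ≤
        cost I.weight (Z \ (I.safeBridges Z ∩ (T ∩ I.safe))) :=
      cost_mono (fun e he => I.weight_nonneg e (hZ.1 he.1)) fun e he => ⟨he.1, fun h => he.2 h.2⟩
    linarith
  have h6 := cost_union_le (w := I.weight) (X := T ∩ I.safe) (Y := H) fun e he =>
    I.weight_nonneg e (he.elim (fun h => I.safe_subset h.2) fun h => hHE h)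
  have h7 := mul_le_mul_of_nonneg_left h2 hlam
  linarith

lemma thresholdValues_subset (I : Instance V E) (p : E → ℝ) :
    I.thresholdValues p ⊆ Set.Icc 0 1 := by
  rintro t ⟨e, ⟨-, rfl⟩ | ⟨-, hne, rfl⟩⟩
  · exact ⟨I.upperThreshold_nonneg p e, I.upperThreshold_le_one p e⟩
  · refine ⟨Real.sInf_nonneg fun _ h => h.1.1, ?_⟩
    obtain ⟨a, ha⟩ := hne
    exact (csInf_le ⟨0, fun _ h => h.1.1⟩ ha).trans ha.1.2

/-- The average over the scaling factors of the bounds for Algorithm C. -/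
lemma le_of_forall_scalingFactors {z O : ℝ} {S : Set E} (hp : I.IsTieBreaking p)
    (hS : S ⊆ I.safe) (hfin : (I.thresholdValues p).Finite)
    (hz : ∀ a ∈ I.scalingFactors p, ∃ T, I.IsSelectedMST p a T ∧
      z ≤ cost I.weight (T ∩ I.safe) + lam * (O - cost I.weight (S ∩ (T ∩ I.safe)) +
        cost (fun e => I.upperThreshold p e * I.weight e) (S \ (T ∩ I.safe)))) :
    z ≤ I.mstCost p 1 + lam * (O -
      cost (fun e => I.upperThreshold p e ^ 2 * I.weight e) S) := by
  set θ := I.upperThreshold p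
  have hθ0 : ∀ e, 0 ≤ θ e := I.upperThreshold_nonneg p
  have hθ1 : ∀ e, θ e ≤ 1 := I.upperThreshold_le_one p
  -- `m` and `n` integrate over the factors up to `t`: an edge of `S` contributes its weight to `m`
  -- below its threshold and θ times its weight to `n` above it.
  let m : ℝ → ℝ := fun t => cost (fun e => min t (θ e) * I.weight e) S
  let n : ℝ → ℝ := fun t => cost (fun e => θ e * (t - min t (θ e)) * I.weight e) S
  let h : ℝ → ℝ := fun t => I.mstCost p t + lam * (t * O - m t + n t)
  have hW : ∀ t ∈ I.scalingFactors p, 0 ≤ t ∧ t ≤ 1 := by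
    rintro t (ht | rfl | rfl)
    exacts [I.thresholdValues_subset p ht, by norm_num, by norm_num]
  have hstep : ∀ s ∈ I.scalingFactors p, ∀ t ∈ I.scalingFactors p, s < t →
      (∀ x ∈ I.scalingFactors p, x < t → x ≤ s) → (t - s) * z ≤ h t - h s := by
    intro s hs t ht hst hmax
    obtain ⟨T, hT, hzT⟩ := hz t ht
    have hK := hT.inter_safe_eq hp ((hW s hs).1.trans_lt hst) (hW t ht).2
    -- No threshold of an edge of `S` lies strictly between the consecutive factors `s` and `t`.
    have hsplit : ∀ e ∈ S, (e ∈ T ∩ I.safe ∧ t ≤ θ e) ∨ (e ∉ T ∩ I.safe ∧ θ e ≤ s) := by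
      intro e he
      by_cases hte : t ≤ θ e
      · exact .inl ⟨by rw [hK]; exact ⟨hS he, hte⟩, hte⟩
      · refine .inr ⟨fun h => hte (by rw [hK] at h; exact h.2), hmax _ ?_ (not_le.1 hte)⟩
        exact .inl (upperThreshold_mem_thresholdValues (hS he))
    have hm : (t - s) * cost I.weight (S ∩ (T ∩ I.safe)) = m t - m s := by
      simp only [m, cost]
      rw [Finset.mul_sum, ← Finset.sum_sub_distrib]
      refine Finset.sum_congr rfl fun e _ => ?_
      by_cases he : e ∈ S
      · rcases hsplit e he with ⟨h1, h2⟩ | ⟨h1, h2⟩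
        · rw [Set.indicator_of_mem (show e ∈ S ∩ (T ∩ I.safe) from ⟨he, h1⟩),
            Set.indicator_of_mem he, Set.indicator_of_mem he, min_eq_left h2,
            min_eq_left (hst.le.trans h2)]
          ring
        · rw [Set.indicator_of_notMem fun h => h1 h.2, Set.indicator_of_mem he,
            Set.indicator_of_mem he, min_eq_right h2, min_eq_right (h2.trans hst.le)]
          ring
      · simp [he]
    have hn : (t - s) * cost (fun e => θ e * I.weight e) (S \ (T ∩ I.safe)) = n t - n s := by
      simp only [n, cost]
      rw [Finset.mul_sum, ← Finset.sum_sub_distrib]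
      refine Finset.sum_congr rfl fun e _ => ?_
      by_cases he : e ∈ S
      · rcases hsplit e he with ⟨h1, h2⟩ | ⟨h1, h2⟩
        · rw [Set.indicator_of_notMem fun h => h.2 h1, Set.indicator_of_mem he,
            Set.indicator_of_mem he, min_eq_left h2, min_eq_left (hst.le.trans h2)]
          ring
        · rw [Set.indicator_of_mem (show e ∈ S \ (T ∩ I.safe) from ⟨he, h1⟩), Set.indicator_of_mem he,
            Set.indicator_of_mem he, min_eq_right h2, min_eq_right (h2.trans hst.le)]
          ring
      · simp [he]
    have h1 := mul_le_mul_of_nonneg_left hzT (sub_nonneg.2 hst.le)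
    have h2 := hT.mul_cost_le s
    have h3 : (t - s) * (cost I.weight (T ∩ I.safe) + lam * (O -
        cost I.weight (S ∩ (T ∩ I.safe)) + cost (fun e => θ e * I.weight e) (S \ (T ∩ I.safe)))) =
        (t - s) * cost I.weight (T ∩ I.safe) + lam * ((t - s) * O - (m t - m s) + (n t - n s)) := by
      rw [← hm, ← hn]
      ring
    simp only [h]
    linarith
  have h0 : (0 : ℝ) ∈ I.scalingFactors p := .inr (.inl rfl)
  have h1 : (1 : ℝ) ∈ I.scalingFactors p := .inr (.inr rfl)
  have hfin' : (I.scalingFactors p).Finite := hfin.union (Set.toFinite _)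
  have hmain := mul_le_sub_of_consecutive hfin' h0 (fun t ht => (hW t ht).1) hstep 1 h1
  have hm0 : m 0 = 0 := by
    simp [m, cost, min_eq_left (hθ0 _), Set.indicator]
  have hn0 : n 0 = 0 := by
    simp [n, cost, min_eq_left (hθ0 _), Set.indicator]
  have hmn : m 1 - n 1 = cost (fun e => θ e ^ 2 * I.weight e) S := by
    simp only [m, n, cost]
    rw [← Finset.sum_sub_distrib]
    refine Finset.sum_congr rfl fun e _ => ?_
    by_cases he : e ∈ S
    · simp only [he, Set.indicator_of_mem, min_eq_right (hθ1 e)]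
      ring
    · simp [he]
  have hg0 := I.mstCost_zero_nonneg p
  simp only [h, hm0, hn0] at hmain
  rw [← hmn]
  linarith

end Instance
end FGC

/-! ### Combining the bounds. -/

theorem mainTheorem6 {V E : Type*} [Finite V] [Fintype E]
    (I : FGC.Instance V E) (hcopies : I.HasUnsafeCopies)
    (p : E → ℝ) (hp : I.IsTieBreaking p)
    (lam tau : ℝ) (hlam : 1 ≤ lam) (htau : 1 ≤ tau)
    (N : ℕ) (hN : 1 ≤ N) (hthr : (I.thresholdValues p).encard ≤ N) :
    ∃ rho : ℝ, IsGreatest (FGC.problemValues N lam) rho ∧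
      ∀ Z : Set E, I.IsOutput p lam tau Z →
        I.IsFeasible Z ∧
          ∀ Zopt : Set E, I.IsOptimal Zopt →
            FGC.cost I.weight Z ≤ rho * FGC.cost I.weight Zopt := by
  obtain ⟨hlamv, rho, hrho⟩ := FGC.exists_isGreatest_problemValues (lam := lam) hN
  refine ⟨rho, hrho, ?_⟩
  rintro Z ⟨ZA, T, ZB, ZC, hA, hBC, hmem, hle⟩
  have hlam0 : 0 ≤ lam := zero_le_one.trans hlam
  constructor
  · rcases hmem with (rfl | ⟨a, ha, rfl⟩) | ⟨a, ha, rfl⟩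
    · exact hA.isFeasible
    · exact (hBC a ha).2.1.isFeasible (hBC a ha).1.1.1.1
    · exact (hBC a ha).2.2.isFeasible
  intro Zopt hZopt
  obtain ⟨Y, hY, hYmin⟩ := hZopt.exists_min_priority p
  have hO : FGC.cost I.weight Zopt = FGC.cost I.weight Y := le_antisymm (hZopt.2 _ hY.1) (hY.2 _ hZopt.1)
  have hmin : I.SafeMinimal p Y (I.safeBridges Y) := fun f hf U hU =>
    hY.exists_crosses hYmin hf hU
  rw [hO]
  set S := I.safeBridges Y
  set θ := I.upperThreshold p
  have hSw : ∀ e ∈ S, 0 ≤ I.weight e := fun e he => I.weight_nonneg e (hY.1.1 he.1)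
  have hθ0 : ∀ e, 0 ≤ θ e := I.upperThreshold_nonneg p
  have hθ1 : ∀ e, θ e ≤ 1 := I.upperThreshold_le_one p
  have hzA := (hle ZA (.inl (.inl rfl))).trans (hA.cost_le hlam0 hmin hcopies hp hY.1)
  have hzC := FGC.Instance.le_of_forall_scalingFactors (S := S) hp FGC.Instance.safeBridges_subset_safe
    (Set.finite_of_encard_le_coe hthr) fun a ha =>
      ⟨T a, (hBC a ha).1, (hle (ZC a) (.inr ⟨a, ha, rfl⟩)).trans
        ((hBC a ha).2.2.cost_le hlam0 hmin hcopies hp hY.1)⟩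
  have hmst := FGC.Instance.mstCost_one_le_of_safeMinimal hmin hcopies hp hY.1
  have hO0 : 0 ≤ FGC.cost I.weight Y := FGC.cost_nonneg fun e he => I.weight_nonneg e (hY.1.1 he)
  have hD0 : 0 ≤ FGC.cost (fun e => θ e * I.weight e) S :=
    FGC.cost_nonneg fun e he => mul_nonneg (hθ0 e) (hSw e he)
  have hD20 : 0 ≤ FGC.cost (fun e => θ e ^ 2 * I.weight e) S :=
    FGC.cost_nonneg fun e he => mul_nonneg (sq_nonneg _) (hSw e he)
  have hDβ : FGC.cost (fun e => θ e * I.weight e) S ≤ FGC.cost I.weight S := by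
    refine Finset.sum_le_sum fun e _ => ?_
    by_cases he : e ∈ S
    · simpa [he] using mul_le_of_le_one_left (hSw e he) (hθ1 e)
    · simp [he]
  have hσ : FGC.cost I.weight S + (lam - 1) * FGC.cost (fun e => θ e * I.weight e) S +
      lam * FGC.cost (fun e => θ e ^ 2 * I.weight e) S =
      FGC.cost (fun e => (1 + θ e * (lam - 1 + lam * θ e)) * I.weight e) S := by
    simp only [FGC.cost]
    rw [Finset.mul_sum, Finset.mul_sum, ← Finset.sum_add_distrib, ← Finset.sum_add_distrib]
    refine Finset.sum_congr rfl fun e _ => ?_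
    by_cases he : e ∈ S
    · simp only [he, Set.indicator_of_mem]
      ring
    · simp [he]
  have hθS : (θ '' S).encard ≤ N := by
    refine (Set.encard_le_encard ?_).trans hthr
    rintro _ ⟨e, he, rfl⟩
    exact FGC.Instance.upperThreshold_mem_thresholdValues he.2.1
  generalize hβ' : FGC.cost I.weight S = β at *
  generalize hD' : FGC.cost (fun e => θ e * I.weight e) S = D at *
  generalize hD2' : FGC.cost (fun e => θ e ^ 2 * I.weight e) S = D2 at *
  generalize FGC.cost I.weight Y = O at *
  generalize FGC.cost I.weight Z = z at *
  set σ := β + (lam - 1) * D + lam * D2 with hσdef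
  have hlD : 0 ≤ (lam - 1) * D := mul_nonneg (sub_nonneg.2 hlam) hD0
  have hlD2 : 0 ≤ lam * D2 := mul_nonneg hlam0 hD20
  rcases lt_or_ge 0 σ with hpos | hneg
  · have hv := hrho.2 (FGC.mem_problemValues hlam hSw hN hθS (fun e => ⟨hθ0 e, hθ1 e⟩) hσ hpos)
    rw [hD'] at hv
    refine le_trans ?_ (mul_le_mul_of_nonneg_right hv hO0)
    have hq0 : 0 ≤ D / σ := div_nonneg hD0 hpos.le
    have hqσ : D / σ * σ = D := div_mul_cancel₀ D hpos.ne'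
    -- `D ≤ β` gives `lam * D ≤ β + (lam - 1) * D ≤ σ`.
    have hq1 : lam * (D / σ) ≤ 1 := by
      rw [← mul_div_assoc, div_le_one hpos]
      linarith
    generalize D / σ = q at *
    -- For `σ ≤ O` Algorithm A suffices, as `D = q * σ ≤ q * O`. Otherwise the averaged bound is
    -- `lam * O + O - (1 - lam * q) * σ`, which does not increase with `σ`, so `σ` may be lowered to
    -- `O`.
    rcases le_total σ O with hσO | hσO
    · have h1 := mul_le_mul_of_nonneg_left hσO hq0
      have h2 := mul_le_mul_of_nonneg_left h1 hlam0
      rw [hqσ] at h2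
      linarith
    · have h1 := mul_le_mul_of_nonneg_right hq1 (sub_nonneg.2 hσO)
      have h2 : lam * D = lam * q * σ := by rw [mul_assoc, hqσ]
      linarith
  -- Here `σ` vanishes, and Algorithm A alone gives the factor `lam`, itself a value of the problem.
  · have hD : D = 0 := by linarith
    have h1 := mul_le_mul_of_nonneg_right (hrho.2 hlamv) hO0
    rw [hD, add_zero] at hzA
    linarith
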